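/- Let $d\ge 1$, let $\Omega\subset\mathbb{R}^d$ be a nonempty bounded open set (for instance a bounded Lipschitz, locally star-shaped domain), and let $a,b\in\mathbb{R}$ with $a>0$, $b\neq 0$. Let $\Delta$ be the Dirichlet Laplacian on $L^2(\Omega;\mathbb{R})$, with domain $\{u\in H_0^1(\Omega):\Delta u\in L^2(\Omega)\}$, where $\Delta u$ is taken in the weak sense, and let $$\mathcal{A}=\begin{pmatrix} a\Delta & -b\Delta\\ b\Delta & a\Delta\end{pmatrix}$$ act on $L^2(\Omega;\mathbb{R}^2)$, with both components in the domain of $\Delta$. Let $B=(1,0)$, i.e. $B(z_1,z_2)^\top=z_1$. Then $\mathcal{A}$ generates a unique strongly continuous semigroup $\{e^{\mathcal{A}t}\}_{t\ge 0}$ on $L^2(\Omega;\mathbb{R}^2)$, and for every $T>0$ and every $S\in(0,T)$ the following hold. 1. There exists $z\in L^2(\Omega;\mathbb{R}^2)\setminus\{0\}$ such that $Be^{\mathcal{A}S}z=0$ in $L^2(\Omega;\mathbb{R})$; that is, the first component of the solution with initial state $z$ vanishes identically at time $S$. 2. Consequently, the single-time-point interpolation observability inequality fails: for every measurable set $\omega\subset\Omega$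 of positive Lebesgue measure and every $\theta\in(0,1)$, there is no constant $C>0$ such that $$\|e^{\mathcal{A}T}z\|_{L^2(\Omega;\mathbb{R}^2)}\le C\,\|\chi_{\omega}Be^{\mathcal{A}S}z\|_{L^1(\Omega;\mathbb{R})}^{1-\theta}\,\|z\|_{L^2(\Omega;\mathbb{R}^2)}^{\theta}\quad\text{for all } z\in L^2(\Omega;\mathbb{R}^2).$$ -/

import Mathlib

open MeasureTheory Filter Topology TopologicalSpace
open scoped NNReal ENNReal Distributions

noncomputable section

namespace CoupledParabolic

/-- `ℝ^k` with its Euclidean norm. -/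
abbrev Eucl (k : ℕ) : Type := EuclideanSpace ℝ (Fin k)

/-- The Hilbert space `L²(Ω; ℝ^k)`. -/
abbrev L2Vec {d : ℕ} (Ω : Opens (Eucl d)) (k : ℕ) : Type :=
  Lp (Eucl k) 2 (volume.restrict (Ω : Set (Eucl d)))

/-- The Hilbert space `L²(Ω; ℝ)`. -/
abbrev L2Scal {d : ℕ} (Ω : Opens (Eucl d)) : Type :=
  Lp ℝ 2 (volume.restrict (Ω : Set (Eucl d)))

/-- The map `(z₁, …, z_k) ↦ z_i` from `L²(Ω; ℝ^k)` to `L²(Ω; ℝ)`. -/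
def comp {d k : ℕ} (Ω : Opens (Eucl d)) (i : Fin k) : L2Vec Ω k →L[ℝ] L2Scal Ω :=
  (EuclideanSpace.proj i : Eucl k →L[ℝ] ℝ).compLpL 2 (volume.restrict (Ω : Set (Eucl d)))

/-- The observation operator `B = (1, 0)`: `B (z₁, z₂)ᵀ = z₁`. -/
def obsB {d : ℕ} (Ω : Opens (Eucl d)) : L2Vec Ω 2 →L[ℝ] L2Scal Ω :=
  comp Ω 0

/-- `u ∈ H₀¹(Ω)` with `∇u = G`: some sequence of functions in `C_c^∞(Ω)` converges to `u` in
`L²(Ω)` while its gradients converge to `G` in `L²(Ω; ℝ^d)`. In other words, `u` belongs to the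
closure of `C_c^∞(Ω)` in `H¹(Ω)`, and `G` is its weak gradient. -/
def IsH10WithGradient {d : ℕ} (Ω : Opens (Eucl d)) (u : L2Scal Ω) (G : L2Vec Ω d) : Prop :=
  ∃ φ : ℕ → 𝓓(Ω, ℝ),
    Tendsto (fun n => eLpNorm (fun x => φ n x - u x) 2 (volume.restrict (Ω : Set (Eucl d))))
      atTop (𝓝 0) ∧
    Tendsto (fun n => eLpNorm (fun x => gradient (φ n) x - G x) 2
      (volume.restrict (Ω : Set (Eucl d)))) atTop (𝓝 0)

/-- The graph of the Dirichlet Laplacian on `L²(Ω)`: `u ∈ H₀¹(Ω)`, `f ∈ L²(Ω)` and `Δu = f`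
weakly, that is `∫_Ω ∇u · ∇φ = - ∫_Ω f φ` for all `φ ∈ C_c^∞(Ω)`. Hence the domain is
`{u ∈ H₀¹(Ω) : Δu ∈ L²(Ω)}`. -/
def IsDirichletLaplacian {d : ℕ} (Ω : Opens (Eucl d)) (u f : L2Scal Ω) : Prop :=
  ∃ G : L2Vec Ω d, IsH10WithGradient Ω u G ∧
    ∀ φ : 𝓓(Ω, ℝ),
      ∫ x in (Ω : Set (Eucl d)), inner ℝ (G x) (gradient φ x)
        = - ∫ x in (Ω : Set (Eucl d)), f x * φ x

/-- The graph of the operator matrix `𝒜 = [[aΔ, -bΔ], [bΔ, aΔ]]` on `L²(Ω; ℝ²)`, with `Δ` the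
Dirichlet Laplacian acting on each component: `z` is in the domain and `𝒜 z = w`. -/
def opA {d : ℕ} (Ω : Opens (Eucl d)) (a b : ℝ) (z w : L2Vec Ω 2) : Prop :=
  ∃ f₁ f₂ : L2Scal Ω,
    IsDirichletLaplacian Ω (comp Ω 0 z) f₁ ∧
    IsDirichletLaplacian Ω (comp Ω 1 z) f₂ ∧
    comp Ω 0 w = a • f₁ - b • f₂ ∧
    comp Ω 1 w = b • f₁ + a • f₂

/-- `E` is a strongly continuous (`C₀`) semigroup of bounded operators on `H`, and its
infinitesimal generator is the operator with graph `𝒢`: `(E(t) z - z) / t → w` as `t → 0+`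
if and only if `𝒢 z w`. -/
structure IsSemigroupGeneratedBy {H : Type*} [NormedAddCommGroup H] [NormedSpace ℝ H]
    (𝒢 : H → H → Prop) (E : ℝ≥0 → H →L[ℝ] H) : Prop where
  map_zero : E 0 = ContinuousLinearMap.id ℝ H
  map_add : ∀ s t : ℝ≥0, E (s + t) = (E s).comp (E t)
  strong_cont : ∀ z : H, Tendsto (fun t : ℝ≥0 => E t z) (𝓝 0) (𝓝 z)
  generator : ∀ z w : H,
    Tendsto (fun t : ℝ≥0 => (t : ℝ)⁻¹ • (E t z - z)) (𝓝[>] 0) (𝓝 w) ↔ 𝒢 z w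

/-- The observed quantity `‖χ_ω f‖_{L¹(Ω)}`. -/
def obsNorm {d : ℕ} (Ω : Opens (Eucl d)) (ω : Set (Eucl d)) (f : L2Scal Ω) : ℝ :=
  ∫ x in (Ω : Set (Eucl d)), |ω.indicator (fun y => f y) x|

end CoupledParabolic

end

noncomputable section

namespace CoupledParabolic

/-! ### Scalar estimates for `exp (τ (1 - 1/r))` on the segment `[0, 1]`. -/

section FunctionalCalculus

/-! Writing `(z₁, z₂)` as `z₁ + i z₂` turns the operator matrix into `c Δ` with `c = a + i b`,
acting on `L²(Ω; ℂ)`, and the observation `B` into the real part. For real `h ≠ 0` put `z = i exp(c̄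
S Δ) h`. Then `exp(c S Δ) z = i exp(2 a S Δ) h`, which is purely imaginary because the heat operator
at a real time preserves real functions. So the observation vanishes at time `S`, while `z ≠ 0`
because each `exp(τ Δ)` with `Re τ > 0` is injective (`heatOp_injective`). Injectivity also gives
`exp(c T Δ) z ≠ 0`, whereas the right side of the interpolation inequality is `0`.

No eigenfunction expansion is used. The resolvent `R = (1 - Δ)⁻¹` is the compression to `L²` of the
orthogonal projection onto the graph of the gradient on `H₀¹` (`isDirichletLaplacian_iff`). It is
self-adjoint with spectrum in `[0, 1]`, and `exp(τ Δ)` is the continuous function `exp (τ (1 -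
1/z))` of `R`. Scalar bounds on `[0, 1]` become operator bounds, which identify the generator
(`isSemigroupGeneratedBy_heatSemigroup`). Uniqueness of the semigroup follows from dissipativity of
`c Δ` (`unique_of_dissipative`). -/

/-- The function `z ↦ exp (τ (1 - 1/z))`, extended by `0` at `z = 0`. -/
def resolventExp (τ z : ℂ) : ℂ := if z = 0 then 0 else Complex.exp (τ * (1 - z⁻¹))

lemma resolventExp_ofReal_zero (τ : ℂ) : resolventExp τ ((0 : ℝ) : ℂ) = 0 := by
  simp [resolventExp]

lemma resolventExp_ofReal (τ : ℂ) {r : ℝ} (hr : 0 < r) :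
    resolventExp τ r = Complex.exp (τ * ((1 - r⁻¹ : ℝ) : ℂ)) := by
  have : (r : ℂ) ≠ 0 := by exact_mod_cast hr.ne'
  simp [resolventExp, this]

lemma resolventExp_mul (τ σ z : ℂ) :
    resolventExp τ z * resolventExp σ z = resolventExp (τ + σ) z := by
  unfold resolventExp
  split_ifs
  · simp
  · rw [← Complex.exp_add, add_mul]

lemma norm_exp_mul_ofReal (τ : ℂ) (y : ℝ) :
    ‖Complex.exp (τ * (y : ℂ))‖ = Real.exp (τ.re * y) := by
  simp [Complex.norm_exp]

lemma one_sub_inv_nonpos {r : ℝ} (hr : 0 < r) (hr1 : r ≤ 1) : 1 - r⁻¹ ≤ 0 := by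
  have := (one_le_inv₀ hr).2 hr1
  linarith

lemma norm_resolventExp_le_one {τ : ℂ} (hτ : 0 ≤ τ.re) {r : ℝ} (h0 : 0 ≤ r) (h1 : r ≤ 1) :
    ‖resolventExp τ r‖ ≤ 1 := by
  rcases h0.eq_or_lt with rfl | h
  · rw [resolventExp_ofReal_zero]; simp
  · rw [resolventExp_ofReal τ h, norm_exp_mul_ofReal]
    exact Real.exp_le_one_iff.2 (mul_nonpos_of_nonneg_of_nonpos hτ (one_sub_inv_nonpos h h1))

/-- From `x ≤ exp x` at `x = Re τ / r`. This decay gives continuity at `0`, the only delicate point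
of the spectrum. -/
lemma norm_resolventExp_le_mul {τ : ℂ} (hτ : 0 < τ.re) {r : ℝ} (h0 : 0 ≤ r) :
    ‖resolventExp τ r‖ ≤ Real.exp τ.re / τ.re * r := by
  rcases h0.eq_or_lt with rfl | h
  · rw [resolventExp_ofReal_zero]; simp
  · rw [resolventExp_ofReal τ h, norm_exp_mul_ofReal, mul_sub, mul_one, Real.exp_sub,
      div_mul_eq_mul_div, div_le_div_iff₀ (Real.exp_pos _) hτ, mul_assoc]
    have h2 := Real.add_one_le_exp (τ.re * r⁻¹)
    have h3 : τ.re ≤ r * Real.exp (τ.re * r⁻¹) := by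
      calc τ.re = r * (τ.re * r⁻¹) := by field_simp
        _ ≤ _ := by gcongr; linarith
    exact mul_le_mul_of_nonneg_left h3 (Real.exp_pos _).le

/-- The real segment `[0, 1]` inside `ℂ`. -/
def unitSegment : Set ℂ := {z | ∃ r : ℝ, 0 ≤ r ∧ r ≤ 1 ∧ z = r}

lemma continuousOn_resolventExp {τ : ℂ} (hτ : 0 < τ.re) :
    ContinuousOn (resolventExp τ) unitSegment := by
  intro z hz
  by_cases h : z = 0
  · subst h
    have h0 : resolventExp τ 0 = 0 := by simp [resolventExp]
    rw [ContinuousWithinAt, h0]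
    apply squeeze_zero_norm' (a := fun z : ℂ => Real.exp τ.re / τ.re * ‖z‖)
    · filter_upwards [self_mem_nhdsWithin] with z hz
      obtain ⟨r, h0, -, rfl⟩ := hz
      simpa [abs_of_nonneg h0] using norm_resolventExp_le_mul hτ h0
    · refine Tendsto.mono_left ?_ nhdsWithin_le_nhds
      have : Continuous fun z : ℂ => Real.exp τ.re / τ.re * ‖z‖ := by fun_prop
      simpa using this.tendsto 0
  · refine ContinuousAt.continuousWithinAt ?_
    have : ContinuousAt (fun z : ℂ => Complex.exp (τ * (1 - z⁻¹))) z := by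
      have := continuousAt_inv₀ h
      fun_prop
    refine this.congr ?_
    filter_upwards [isOpen_ne.mem_nhds h] with w hw
    simp [resolventExp, show w ≠ 0 from hw]

/-- Mean value inequality on the convex left half-plane, where `exp' = exp` is bounded by `1`. The
bound holds for arbitrarily large `s`, as needed for `s = τ (1 - 1/r)` with `r` near `0`. -/
lemma norm_exp_sub_one_le {s : ℂ} (hs : s.re ≤ 0) : ‖Complex.exp s - 1‖ ≤ ‖s‖ := by
  have := Convex.norm_image_sub_le_of_norm_hasDerivWithin_le (f := Complex.exp)
    (f' := Complex.exp) (C := 1) (s := {z : ℂ | z.re ≤ 0}) (x := 0) (y := s)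
    (fun z _ => (Complex.hasDerivAt_exp z).hasDerivWithinAt)
    (fun z hz => by rw [Complex.norm_exp]; exact Real.exp_le_one_iff.2 hz)
    (convex_halfSpace_re_le 0) (by simp) hs
  simpa using this

/-- Mean value inequality again: on the half-plane intersected with the ball of radius `‖s‖`, the
previous lemma bounds the derivative `exp z - 1` by `‖s‖`. -/
lemma norm_exp_sub_one_sub_le {s : ℂ} (hs : s.re ≤ 0) :
    ‖Complex.exp s - 1 - s‖ ≤ ‖s‖ ^ 2 := by
  have := Convex.norm_image_sub_le_of_norm_hasDerivWithin_le
    (f := fun z => Complex.exp z - 1 - z)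
    (f' := fun z => Complex.exp z - 1) (C := ‖s‖)
    (s := {z : ℂ | z.re ≤ 0} ∩ Metric.closedBall 0 ‖s‖) (x := 0) (y := s)
    (fun z _ => by
      exact (((Complex.hasDerivAt_exp z).sub_const 1).sub (hasDerivAt_id z)).hasDerivWithinAt)
    (fun z hz => (norm_exp_sub_one_le hz.1).trans (by simpa using hz.2))
    ((convex_halfSpace_re_le 0).inter (convex_closedBall _ _)) (by simp) ⟨hs, by simp⟩
  simpa [sq] using this

/-- The factor `r` absorbs the singularity of the exponent, since `r (1/r - 1) = 1 - r ≤ 1`. The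
second-order version below needs `r²`. -/
lemma norm_resolventExp_sub_one_mul_le {τ : ℂ} (hτ : 0 ≤ τ.re) {r : ℝ} (h0 : 0 ≤ r)
    (h1 : r ≤ 1) : ‖(resolventExp τ r - 1) * r‖ ≤ ‖τ‖ := by
  rcases h0.eq_or_lt with rfl | h
  · simp
  · have hy := one_sub_inv_nonpos h h1
    rw [resolventExp_ofReal τ h, norm_mul]
    have := norm_exp_sub_one_le (s := τ * ((1 - r⁻¹ : ℝ) : ℂ))
      (by simpa using mul_nonpos_of_nonneg_of_nonpos hτ hy)
    rw [norm_mul, Complex.norm_real, Real.norm_eq_abs, abs_of_nonpos hy] at this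
    rw [Complex.norm_real, Real.norm_eq_abs, abs_of_pos h]
    calc _ ≤ ‖τ‖ * -(1 - r⁻¹) * r := by gcongr
      _ = ‖τ‖ * (1 - r) := by field_simp; ring
      _ ≤ ‖τ‖ := mul_le_of_le_one_right (norm_nonneg _) (by linarith)

lemma norm_resolventExp_sub_sub_le {τ : ℂ} (hτ : 0 ≤ τ.re) {r : ℝ} (h0 : 0 ≤ r)
    (h1 : r ≤ 1) : ‖(resolventExp τ r - 1) * (r * r) - τ * ((r - 1) * r)‖ ≤ ‖τ‖ ^ 2 := by
  rcases h0.eq_or_lt with rfl | h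
  · simp
  · have hy := one_sub_inv_nonpos h h1
    have hrc : (r : ℂ) ≠ 0 := by exact_mod_cast h.ne'
    have := norm_exp_sub_one_sub_le (s := τ * ((1 - r⁻¹ : ℝ) : ℂ))
      (by simpa using mul_nonpos_of_nonneg_of_nonpos hτ hy)
    rw [norm_mul, Complex.norm_real, Real.norm_eq_abs, abs_of_nonpos hy] at this
    have e : (resolventExp τ r - 1) * (r * r) - τ * ((r - 1) * r) =
        (Complex.exp (τ * ((1 - r⁻¹ : ℝ) : ℂ)) - 1 - τ * ((1 - r⁻¹ : ℝ) : ℂ)) * ((r * r : ℝ) : ℂ) := by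
      rw [resolventExp_ofReal τ h]
      push_cast
      field_simp
    rw [e, norm_mul, Complex.norm_real, Real.norm_eq_abs, abs_of_pos (mul_pos h h)]
    calc _ ≤ (‖τ‖ * -(1 - r⁻¹)) ^ 2 * (r * r) := by gcongr
      _ = ‖τ‖ ^ 2 * (1 - r) ^ 2 := by field_simp; ring
      _ ≤ ‖τ‖ ^ 2 := mul_le_of_le_one_right (sq_nonneg _) (by nlinarith)

end FunctionalCalculus

/-! ### The semigroup `exp(t c Δ)` built from an abstract resolvent. -/

section Semigroup

variable {K : Type*} [NormedAddCommGroup K] [InnerProductSpace ℂ K] [CompleteSpace K]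

/-- The properties of `R = (1 - Δ)⁻¹` used to construct `exp (τ Δ)`. -/
structure IsResolvent (R : K →L[ℂ] K) : Prop where
  isSelfAdjoint : IsSelfAdjoint R
  norm_sq_le : ∀ u, ‖R u‖ ^ 2 ≤ (inner ℂ (R u) u).re
  injective : ∀ u, R u = 0 → u = 0

namespace IsResolvent

variable {R : K →L[ℂ] K} (hR : IsResolvent R)
include hR

lemma norm_le_one : ‖R‖ ≤ 1 := by
  refine R.opNorm_le_bound zero_le_one fun u => ?_
  have h1 := hR.norm_sq_le u
  have h2 := (Complex.re_le_norm _).trans (norm_inner_le_norm (𝕜 := ℂ) (R u) u)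
  rw [one_mul]
  by_contra! h
  nlinarith [norm_nonneg u, norm_nonneg (R u)]

lemma nonneg : 0 ≤ R := by
  rw [ContinuousLinearMap.nonneg_iff_isPositive, ContinuousLinearMap.isPositive_def']
  refine ⟨hR.isSelfAdjoint, fun u => ?_⟩
  exact (sq_nonneg _).trans (hR.norm_sq_le u)

/-- Self-adjointness makes the spectrum real, positivity makes it nonnegative, and `‖R‖ ≤ 1` bounds
it by `1`. -/
lemma spectrum_subset : spectrum ℂ R ⊆ unitSegment := by
  intro z hz
  have hre := hR.isSelfAdjoint.mem_spectrum_eq_re hz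
  have hz' : z.re ∈ spectrum ℝ R := by
    rw [← spectrum.algebraMap_mem_iff ℂ]
    simpa [← hre] using hz
  refine ⟨z.re, spectrum_nonneg_of_nonneg hR.nonneg hz', ?_, hre⟩
  rcases subsingleton_or_nontrivial K with h | h
  · simp at hz
  · exact (Complex.re_le_norm z).trans ((spectrum.norm_le_norm_of_mem hz).trans hR.norm_le_one)

lemma continuousOn {τ : ℂ} (hτ : 0 < τ.re) : ContinuousOn (resolventExp τ) (spectrum ℂ R) :=
  (continuousOn_resolventExp hτ).mono hR.spectrum_subset

/-- The orthogonal complement of the range is the kernel of the adjoint, here the trivial kernel of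
`R` itself. -/
lemma denseRange : DenseRange R := by
  have h := ContinuousLinearMap.orthogonal_range R
  rw [hR.isSelfAdjoint.adjoint_eq] at h
  have h2 : R.ker = ⊥ := by
    rw [Submodule.eq_bot_iff]
    exact fun u hu => hR.injective u hu
  rw [h2] at h
  have := Submodule.topologicalClosure_eq_top_iff.2 h
  rw [← Submodule.dense_iff_topologicalClosure_eq_top] at this
  exact this

end IsResolvent

/-- `exp (τ Δ)` for `R = (1 - Δ)⁻¹`. -/
def heatOp (R : K →L[ℂ] K) (τ : ℂ) : K →L[ℂ] K := if τ = 0 then 1 else cfc (resolventExp τ) R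

/-- The case `τ = 0` is set by hand, because `resolventExp 0` jumps at `0` and need not be
continuous on the spectrum. -/
lemma heatOp_zero (R : K →L[ℂ] K) : heatOp R 0 = 1 := by simp [heatOp]

lemma heatOp_of_re_pos (R : K →L[ℂ] K) {τ : ℂ} (hτ : 0 < τ.re) :
    heatOp R τ = cfc (resolventExp τ) R := by
  rw [heatOp, if_neg]
  rintro rfl
  simp at hτ

namespace IsResolvent

variable {R : K →L[ℂ] K} (hR : IsResolvent R)
include hR

lemma commute_heatOp (τ : ℂ) : Commute (heatOp R τ) R := by
  unfold heatOp
  split_ifs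
  · exact Commute.one_left R
  · exact hR.isSelfAdjoint.commute_cfc (Commute.refl R) _

lemma norm_heatOp_le {τ : ℂ} (hτ : 0 < τ.re) : ‖heatOp R τ‖ ≤ 1 := by
  rw [heatOp_of_re_pos R hτ]
  refine norm_cfc_le zero_le_one fun z hz => ?_
  obtain ⟨r, h0, h1, rfl⟩ := hR.spectrum_subset hz
  exact norm_resolventExp_le_one hτ.le h0 h1

lemma heatOp_mul {τ σ : ℂ} (hτ : 0 < τ.re) (hσ : 0 < σ.re) :
    heatOp R τ * heatOp R σ = heatOp R (τ + σ) := by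
  rw [heatOp_of_re_pos R hτ, heatOp_of_re_pos R hσ,
    heatOp_of_re_pos R (by simpa using add_pos hτ hσ),
    ← cfc_mul _ _ R (hR.continuousOn hτ) (hR.continuousOn hσ)]
  simp only [resolventExp_mul]

lemma norm_heatOp_sub_one_mul_le {τ : ℂ} (hτ : 0 < τ.re) :
    ‖(heatOp R τ - 1) * R‖ ≤ ‖τ‖ := by
  have hsa := hR.isSelfAdjoint.isStarNormal
  have hc := hR.continuousOn hτ
  have e : (heatOp R τ - 1) * R = cfc (fun z => (resolventExp τ z - 1) * z) R := by
    rw [cfc_mul (fun z => resolventExp τ z - 1) (fun z => z) R (by fun_prop) (by fun_prop),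
      cfc_sub (resolventExp τ) (fun _ => 1) R hc, cfc_const_one ℂ R, cfc_id' ℂ R,
      heatOp_of_re_pos R hτ]
  rw [e]
  refine norm_cfc_le (norm_nonneg _) fun z hz => ?_
  obtain ⟨r, h0, h1, rfl⟩ := hR.spectrum_subset hz
  exact norm_resolventExp_sub_one_mul_le hτ.le h0 h1

/-- Since `Δ R = R - 1`, the term `(R - 1) * R` is `Δ R²`: this is the first-order Taylor expansion
of `exp(τ Δ)` on the range of `R²`, with a quadratic remainder. -/
lemma norm_heatOp_sub_sub_le {τ : ℂ} (hτ : 0 < τ.re) :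
    ‖(heatOp R τ - 1) * (R * R) - τ • ((R - 1) * R)‖ ≤ ‖τ‖ ^ 2 := by
  have hsa := hR.isSelfAdjoint.isStarNormal
  have hc := hR.continuousOn hτ
  have e : (heatOp R τ - 1) * (R * R) - τ • ((R - 1) * R) =
      cfc (fun z => (resolventExp τ z - 1) * (z * z) - τ * ((z - 1) * z)) R := by
    rw [cfc_sub (fun z => (resolventExp τ z - 1) * (z * z)) (fun z => τ * ((z - 1) * z)) R
        (by fun_prop) (by fun_prop),
      cfc_const_mul τ (fun z => (z - 1) * z) R (by fun_prop),
      cfc_mul (fun z => resolventExp τ z - 1) (fun z => z * z) R (by fun_prop) (by fun_prop),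
      cfc_mul (fun z => z) (fun z => z) R (by fun_prop) (by fun_prop),
      cfc_mul (fun z => z - 1) (fun z => z) R (by fun_prop) (by fun_prop),
      cfc_sub (resolventExp τ) (fun _ => 1) R hc, 
      cfc_sub (fun z => z) (fun _ => 1) R (by fun_prop), cfc_const_one ℂ R, cfc_id' ℂ R,
      heatOp_of_re_pos R hτ]
  rw [e]
  refine norm_cfc_le (sq_nonneg _) fun z hz => ?_
  obtain ⟨r, h0, h1, rfl⟩ := hR.spectrum_subset hz
  exact norm_resolventExp_sub_sub_le hτ.le h0 h1

lemma norm_heatOp_mul_le {c : ℂ} (hc : 0 < c.re) (t : ℝ≥0) : ‖heatOp R (c * (t : ℝ))‖ ≤ 1 := by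
  rcases eq_zero_or_pos t with rfl | ht
  · simpa [heatOp_zero, ContinuousLinearMap.one_def] using ContinuousLinearMap.norm_id_le
  · exact hR.norm_heatOp_le (by simpa using mul_pos hc ht)

/-- A uniform bound on the operators upgrades strong convergence from the dense range of `R` to the
whole space. -/
lemma tendsto_of_tendsto_range {α : Type*} {l : Filter α} {F : α → K →L[ℂ] K} {G : K →L[ℂ] K}
    {C : ℝ} (hF : ∀ᶠ x in l, ‖F x‖ ≤ C)
    (h : ∀ v, Tendsto (fun x => F x (R v)) l (𝓝 (G (R v)))) (u : K) :
    Tendsto (fun x => F x u) l (𝓝 (G u)) := by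
  rw [Metric.tendsto_nhds]
  intro ε hε
  set M := |C| + ‖G‖ + 1 with hM
  have hM0 : 0 < M := by positivity
  obtain ⟨v, hv⟩ := Metric.denseRange_iff.1 hR.denseRange u (ε / (2 * M)) (by positivity)
  filter_upwards [hF, Metric.tendsto_nhds.1 (h v) (ε / 2) (by positivity)] with x h1 h2
  rw [dist_eq_norm] at hv h2 ⊢
  have e : F x u - G u = F x (u - R v) + (F x (R v) - G (R v)) - G (u - R v) := by
    simp only [map_sub]; abel
  rw [e]
  have h3 := (F x).le_of_opNorm_le (h1.trans (le_abs_self C)) (u - R v)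
  have h4 := G.le_opNorm (u - R v)
  have h5 : M * ‖u - R v‖ < ε / 2 := by
    calc _ < M * (ε / (2 * M)) := by gcongr
      _ = ε / 2 := by field_simp
  have h6 : (|C| + ‖G‖) * ‖u - R v‖ ≤ M * ‖u - R v‖ := by gcongr; linarith
  calc _ ≤ ‖F x (u - R v) + (F x (R v) - G (R v))‖ + ‖G (u - R v)‖ := norm_sub_le _ _
    _ ≤ ‖F x (u - R v)‖ + ‖F x (R v) - G (R v)‖ + ‖G (u - R v)‖ := by gcongr; exact norm_add_le _ _
    _ < ε := by linarith

lemma tendsto_heatOp {c : ℂ} (hc : 0 < c.re) (z : K) :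
    Tendsto (fun t : ℝ≥0 => heatOp R (c * (t : ℝ)) z) (𝓝 0) (𝓝 z) := by
  refine hR.tendsto_of_tendsto_range (F := fun t : ℝ≥0 => heatOp R (c * (t : ℝ))) (G := 1) (C := 1)
    (Eventually.of_forall fun t => hR.norm_heatOp_mul_le hc t) (fun v => ?_) z
  rw [tendsto_iff_norm_sub_tendsto_zero]
  refine squeeze_zero (g := fun t : ℝ≥0 => ‖c‖ * t * ‖v‖) (fun _ => norm_nonneg _) (fun t => ?_) ?_
  · rcases eq_zero_or_pos t with rfl | ht
    · simp [heatOp_zero]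
    · have := hR.norm_heatOp_sub_one_mul_le (τ := c * (t : ℝ)) (by simpa using mul_pos hc ht)
      simpa using ((heatOp R (c * (t : ℝ)) - 1) * R).le_of_opNorm_le this v
  · have : Continuous fun t : ℝ≥0 => ‖c‖ * t * ‖v‖ := by fun_prop
    simpa using this.tendsto 0

/-- The operators `t⁻¹ (exp(t c Δ) - 1) R` are bounded by `‖c‖` through the first-order estimate and
converge on the range of `R` through the second-order one, so density applies. -/
lemma tendsto_heatOp_slope {c : ℂ} (hc : 0 < c.re) (v : K) :
    Tendsto (fun t : ℝ≥0 => (t : ℝ)⁻¹ • (heatOp R (c * (t : ℝ)) (R v) - R v)) (𝓝[>] 0)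
      (𝓝 (c • (R v - v))) := by
  refine hR.tendsto_of_tendsto_range (C := ‖c‖) (G := c • (R - 1))
    (F := fun t : ℝ≥0 => ((t : ℝ) : ℂ)⁻¹ • ((heatOp R (c * (t : ℝ)) - 1) * R)) ?_ (fun v => ?_) v |>.congr ?_
  · filter_upwards [self_mem_nhdsWithin] with t ht
    have ht' : (0 : ℝ) < t := ht
    have := hR.norm_heatOp_sub_one_mul_le (τ := c * (t : ℝ)) (by simpa using mul_pos hc ht')
    rw [norm_smul, norm_inv, Complex.norm_real, Real.norm_eq_abs, abs_of_pos ht',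
      inv_mul_le_iff₀ ht']
    refine this.trans_eq ?_
    simp [mul_comm]
  · rw [tendsto_iff_norm_sub_tendsto_zero]
    refine squeeze_zero' (g := fun t : ℝ≥0 => ‖c‖ ^ 2 * t * ‖v‖)
      (Eventually.of_forall fun _ => norm_nonneg _) ?_ ?_
    · filter_upwards [self_mem_nhdsWithin] with t ht
      have ht' : (0 : ℝ) < t := ht
      have h1 := hR.norm_heatOp_sub_sub_le (τ := c * (t : ℝ)) (by simpa using mul_pos hc ht')
      have h2 := ContinuousLinearMap.le_of_opNorm_le _ h1 v
      have hc' : ((t : ℝ) : ℂ) ≠ 0 := by exact_mod_cast ht'.ne'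
      have e : (((t : ℝ) : ℂ)⁻¹ • ((heatOp R (c * (t : ℝ)) - 1) * R)) (R v) - (c • (R - 1)) (R v) =
          ((t : ℝ) : ℂ)⁻¹ • (((heatOp R (c * (t : ℝ)) - 1) * (R * R) -
            (c * (t : ℝ)) • ((R - 1) * R)) v) := by
        simp only [smul_apply, mul_apply_eq_comp,
          sub_apply, one_apply_eq_self, smul_sub, smul_smul]
        congr 2 <;> field_simp
      rw [e, norm_smul, norm_inv, Complex.norm_real, Real.norm_eq_abs, abs_of_pos ht',
        inv_mul_le_iff₀ ht']
      refine h2.trans_eq ?_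
      simp
      ring
    · have : Continuous fun t : ℝ≥0 => ‖c‖ ^ 2 * t * ‖v‖ := by fun_prop
      have := this.tendsto 0
      simp only [NNReal.coe_zero, mul_zero, zero_mul] at this
      exact this.mono_left nhdsWithin_le_nhds
  · intro t
    simp [← Complex.ofReal_inv, Complex.coe_smul]

end IsResolvent

/-- The graph of `c Δ` for `R = (1 - Δ)⁻¹`. -/
def resolventGraph (R : K →L[ℂ] K) (c : ℂ) (z w : K) : Prop := ∃ v, z = R v ∧ w = c • (R v - v)

/-- The semigroup `exp (t c Δ)` as a family of real linear operators. -/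
def heatSemigroup (R : K →L[ℂ] K) (c : ℂ) (t : ℝ≥0) : K →L[ℝ] K :=
  (heatOp R (c * (t : ℝ))).restrictScalars ℝ

lemma heatSemigroup_apply (R : K →L[ℂ] K) (c : ℂ) (t : ℝ≥0) (z : K) :
    heatSemigroup R c t z = heatOp R (c * (t : ℝ)) z := rfl

namespace IsResolvent

variable {R : K →L[ℂ] K} (hR : IsResolvent R)
include hR

theorem isSemigroupGeneratedBy_heatSemigroup {c : ℂ} (hc : 0 < c.re) :
    IsSemigroupGeneratedBy (resolventGraph R c) (heatSemigroup R c) where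
  map_zero := by
    ext z
    simp [heatSemigroup_apply, heatOp_zero]
  map_add s t := by
    ext z
    simp only [ContinuousLinearMap.comp_apply, heatSemigroup_apply]
    rcases eq_zero_or_pos s with rfl | hs
    · simp [heatOp_zero]
    rcases eq_zero_or_pos t with rfl | ht
    · simp [heatOp_zero]
    rw [← mul_apply_eq_comp, hR.heatOp_mul (by simpa using mul_pos hc hs)
      (by simpa using mul_pos hc ht)]
    simp [mul_add]
  strong_cont z := hR.tendsto_heatOp hc z
  generator z w := by
    constructor
    · intro h
      have hc0 : c ≠ 0 := by rintro rfl; simp at hc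
      -- Applying `R` to the difference quotient and commuting it inside gives a limit already
      -- known, hence `R w = c (R z - z)`. Solving for `z` yields the preimage `z - c⁻¹ w`.
      have h1 := (R.continuous.tendsto w).comp h
      have h2 : R w = c • (R z - z) := by
        refine tendsto_nhds_unique (h1.congr fun t => ?_) (hR.tendsto_heatOp_slope hc z)
        have := congrArg (fun T : K →L[ℂ] K => T z) (hR.commute_heatOp (c * (t : ℝ))).eq
        simp only [mul_apply_eq_comp] at this
        simp [heatSemigroup_apply, this]
      refine ⟨z - c⁻¹ • w, ?_, ?_⟩
      · rw [map_sub, map_smul, h2, smul_smul, inv_mul_cancel₀ hc0]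
        simp
      · rw [map_sub, map_smul, h2, smul_smul, inv_mul_cancel₀ hc0]
        simp [smul_smul, hc0]
    · rintro ⟨v, rfl, rfl⟩
      exact hR.tendsto_heatOp_slope hc v

/-- For real `s` the function `resolventExp s` is real on the spectrum. -/
lemma isSelfAdjoint_heatOp_ofReal (s : ℝ) : IsSelfAdjoint (heatOp R s) := by
  unfold heatOp
  split_ifs
  · exact .one _
  · rw [isSelfAdjoint_iff, ← cfc_star]
    refine cfc_congr fun z hz => ?_
    obtain ⟨r, -, -, rfl⟩ := hR.spectrum_subset hz
    simp only [resolventExp]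
    split_ifs
    · simp
    · simp [← Complex.exp_conj]

/-- At real times the operator `A` for half the time is self-adjoint, so `A² z = 0` forces `‖A z‖² =
⟨A² z, z⟩ = 0`. Halving repeatedly, `z` is killed at times tending to `0`, and strong continuity
gives `z = 0`. -/
lemma heatOp_injective {τ : ℂ} (hτ : 0 < τ.re) {z : K} (hz : heatOp R τ z = 0) : z = 0 := by
  have key : ∀ n : ℕ, heatOp R (((τ.re + 1) / 2 ^ n : ℝ) : ℂ) z = 0 := by
    intro n
    induction n with
    | zero =>
      -- Composing with parameter `1 - i Im τ` makes the total time real; the added `1` keeps the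
      -- real part of this factor positive.
      have e : (((τ.re + 1) / 2 ^ 0 : ℝ) : ℂ) = (1 - τ.im * Complex.I) + τ := by
        apply Complex.ext <;> simp [add_comm]
      rw [e, ← hR.heatOp_mul (by simp) hτ, mul_apply_eq_comp, hz, map_zero]
    | succ n ih =>
      have hp : 0 < ((((τ.re + 1) / 2 ^ (n + 1) : ℝ) : ℂ)).re := by
        rw [Complex.ofReal_re]; positivity
      set A := heatOp R (((τ.re + 1) / 2 ^ (n + 1) : ℝ) : ℂ) with hA
      have h2 : A * A = heatOp R (((τ.re + 1) / 2 ^ n : ℝ) : ℂ) := by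
        rw [hA, hR.heatOp_mul hp hp]
        congr 1
        push_cast
        ring
      rw [← h2, mul_apply_eq_comp] at ih
      have h3 : inner ℂ (A z) (A z) = 0 := by
        have := ContinuousLinearMap.adjoint_inner_left A z (A z)
        rw [(hR.isSelfAdjoint_heatOp_ofReal _).adjoint_eq, ih, inner_zero_left] at this
        exact this.symm
      exact inner_self_eq_zero.1 h3
  have ht : Tendsto (fun n : ℕ => ((τ.re + 1) / 2 ^ n).toNNReal) atTop (𝓝 0) := by
    rw [← Real.toNNReal_zero]
    refine tendsto_real_toNNReal ?_
    simpa [div_eq_mul_inv] using (tendsto_inv_atTop_zero.comp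
      (tendsto_pow_atTop_atTop_of_one_lt (one_lt_two (α := ℝ)))).const_mul (τ.re + 1)
  have h := (hR.tendsto_heatOp (c := 1) (by simp) z).comp ht
  refine tendsto_nhds_unique h (tendsto_const_nhds.congr fun n => ?_)
  rw [Function.comp_apply, one_mul, Real.coe_toNNReal _ (by positivity), key n]

end IsResolvent

end Semigroup

/-! ### Uniqueness of the semigroup with a given dissipative generator. -/

section Uniqueness

namespace IsSemigroupGeneratedBy

section Banach

variable {H : Type*} [NormedAddCommGroup H] [NormedSpace ℝ H] {𝒢 : H → H → Prop}
  {E : ℝ≥0 → H →L[ℝ] H} (hE : IsSemigroupGeneratedBy 𝒢 E)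
include hE

lemma add_apply (s t : ℝ≥0) (z : H) : E (s + t) z = E s (E t z) := by
  rw [hE.map_add]; rfl

/-- Otherwise some times `t n → 0` have unbounded norms `‖E (t n)‖`. Each orbit converges along them
and is therefore bounded, contradicting Banach–Steinhaus. -/
lemma exists_norm_le_near_zero [CompleteSpace H] :
    ∃ δ > 0, ∃ M : ℝ, 1 ≤ M ∧ ∀ t ≤ δ, ‖E t‖ ≤ M := by
  by_contra! h
  have h' : ∀ n : ℕ, ∃ t : ℝ≥0, t ≤ 1 / ((n : ℝ≥0) + 1) ∧ (n : ℝ) + 1 < ‖E t‖ := fun n =>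
    h _ (by positivity) _ (by linarith [n.cast_nonneg (α := ℝ)])
  choose t ht hn using h'
  have ht0 : Tendsto t atTop (𝓝 0) :=
    tendsto_of_tendsto_of_tendsto_of_le_of_le tendsto_const_nhds
      (tendsto_one_div_add_atTop_nhds_zero_nat (𝕜 := ℝ≥0)) (fun _ => zero_le) ht
  obtain ⟨C, hC⟩ := banach_steinhaus (g := fun n => E (t n)) fun z => by
    obtain ⟨C, hC⟩ := ((hE.strong_cont z).comp ht0).norm.bddAbove_range
    exact ⟨C, fun n => hC ⟨n, rfl⟩⟩
  obtain ⟨n, hCn⟩ := exists_nat_gt C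
  linarith [hC n, hn n]

lemma exists_norm_le [CompleteSpace H] (t₀ : ℝ≥0) : ∃ M : ℝ, ∀ t ≤ t₀, ‖E t‖ ≤ M := by
  obtain ⟨δ, hδ, M, hM1, hM⟩ := hE.exists_norm_le_near_zero
  have key : ∀ n : ℕ, ∀ t ≤ (n + 1) * δ, ‖E t‖ ≤ M ^ (n + 1) := by
    intro n
    induction n with
    | zero => simpa using hM
    | succ n ih =>
      intro t ht
      rcases le_total t δ with h | h
      · exact (hM t h).trans (le_self_pow₀ hM1 (by lia))
      · have h1 : t - δ ≤ (n + 1) * δ := by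
          rw [tsub_le_iff_right]
          refine ht.trans_eq ?_
          push_cast
          ring
        rw [← tsub_add_cancel_of_le h, hE.map_add, pow_succ]
        exact (ContinuousLinearMap.opNorm_comp_le _ _).trans
          (mul_le_mul (ih _ h1) (hM δ le_rfl) (norm_nonneg _) (by positivity))
  obtain ⟨n, hn⟩ := exists_nat_ge (t₀ / δ)
  refine ⟨M ^ (n + 1), fun t ht => key n t (ht.trans ?_)⟩
  rw [div_le_iff₀ hδ] at hn
  exact hn.trans (by gcongr; simp)

lemma continuous_apply [CompleteSpace H] (z : H) : Continuous fun t => E t z := by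
  rw [continuous_iff_continuousAt]
  intro t₀
  obtain ⟨M, hM⟩ := hE.exists_norm_le (t₀ + 1)
  rw [ContinuousAt, tendsto_iff_norm_sub_tendsto_zero]
  have h1 : Tendsto (fun t => nndist t t₀) (𝓝 t₀) (𝓝 0) := by
    have : Continuous fun t => nndist t t₀ := by fun_prop
    simpa using this.tendsto t₀
  have h2 : Tendsto (fun t => M * ‖E (nndist t t₀) z - z‖) (𝓝 t₀) (𝓝 0) := by
    have := ((tendsto_iff_norm_sub_tendsto_zero.1 (hE.strong_cont z)).comp h1).const_mul M
    simpa using this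
  refine squeeze_zero' (Eventually.of_forall fun _ => norm_nonneg _) ?_ h2
  have hlt : t₀ < t₀ + 1 := by simp
  filter_upwards [eventually_lt_nhds hlt] with t ht
  rcases le_total t₀ t with h | h
  · have e : nndist t t₀ = t - t₀ := by
      rw [NNReal.nndist_eq, tsub_eq_zero_of_le h]; simp
    have e2 : E t z - E t₀ z = E t₀ (E (t - t₀) z - z) := by
      rw [map_sub, ← hE.add_apply, add_tsub_cancel_of_le h]
    rw [e, e2]
    exact (E t₀).le_of_opNorm_le (hM _ hlt.le) _
  · have e : nndist t t₀ = t₀ - t := by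
      rw [NNReal.nndist_eq, tsub_eq_zero_of_le h]; simp
    have e2 : E t z - E t₀ z = - E t (E (t₀ - t) z - z) := by
      rw [map_sub, ← hE.add_apply, add_tsub_cancel_of_le h, neg_sub]
    rw [e, e2, norm_neg]
    exact (E t).le_of_opNorm_le (hM _ ht.le) _

lemma graph_apply {z w : H} (h : 𝒢 z w) (t : ℝ≥0) : 𝒢 (E t z) (E t w) := by
  rw [← hE.generator] at h ⊢
  refine (((E t).continuous.tendsto w).comp h).congr fun s => ?_
  simp [← hE.add_apply, add_comm]

/-- Only the right derivative is computed, which suffices for the one-sided comparison argument in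
`unique_of_dissipative`. -/
lemma hasDerivWithinAt {z w : H} (h : 𝒢 z w) {t : ℝ} (ht : 0 ≤ t) :
    HasDerivWithinAt (fun s : ℝ => E s.toNNReal z) (E t.toNNReal w) (Set.Ici t) t := by
  refine HasDerivWithinAt.Ici_of_Ioi ?_
  rw [hasDerivWithinAt_iff_tendsto_slope' (by simp)]
  have h1 : Tendsto (fun s : ℝ => (s - t).toNNReal) (𝓝[>] t) (𝓝[>] 0) := by
    refine tendsto_nhdsWithin_iff.2 ⟨?_, ?_⟩
    · have : Continuous fun s : ℝ => (s - t).toNNReal := by fun_prop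
      have := this.tendsto t
      simp only [sub_self, Real.toNNReal_zero] at this
      exact this.mono_left nhdsWithin_le_nhds
    · filter_upwards [self_mem_nhdsWithin] with s hs
      simpa using hs
  refine (((E t.toNNReal).continuous.tendsto w).comp (((hE.generator z w).2 h).comp h1)).congr' ?_
  filter_upwards [self_mem_nhdsWithin] with s hs
  have hs' : 0 ≤ s - t := sub_nonneg.2 (le_of_lt hs)
  have e : s.toNNReal = t.toNNReal + (s - t).toNNReal := by
    rw [← Real.toNNReal_add ht hs']; simp
  simp only [Function.comp_apply, slope_def_module, map_smul, map_sub, ← hE.add_apply, ← e,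
    Real.coe_toNNReal _ hs']

end Banach

variable {H : Type*} [NormedAddCommGroup H] [InnerProductSpace ℝ H] [CompleteSpace H]
  {𝒢 : H → H → Prop}

/-- A densely defined dissipative operator generates at most one semigroup. -/
theorem unique_of_dissipative
    (hdiss : ∀ z₁ w₁ z₂ w₂, 𝒢 z₁ w₁ → 𝒢 z₂ w₂ → inner ℝ (z₁ - z₂) (w₁ - w₂) ≤ 0)
    (hdense : Dense {z | ∃ w, 𝒢 z w}) {E F : ℝ≥0 → H →L[ℝ] H}
    (hE : IsSemigroupGeneratedBy 𝒢 E) (hF : IsSemigroupGeneratedBy 𝒢 F) : E = F := by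
  funext t
  refine ContinuousLinearMap.coeFn_injective
    ((E t).continuous.ext_on hdense (F t).continuous ?_)
  rintro z ⟨w, hzw⟩
  have hd : ∀ s ∈ Set.Ico (0 : ℝ) t, HasDerivWithinAt
      (fun s : ℝ => ‖E s.toNNReal z - F s.toNNReal z‖ ^ 2)
      (2 * inner ℝ (E s.toNNReal z - F s.toNNReal z) (E s.toNNReal w - F s.toNNReal w))
      (Set.Ici s) s := fun s hs =>
    ((hE.hasDerivWithinAt hzw hs.1).sub (hF.hasDerivWithinAt hzw hs.1)).norm_sq
  have hcE := hE.continuous_apply z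
  have hcF := hF.continuous_apply z
  -- The squared distance of the two orbits starts at `0` and, by dissipativity, has nonpositive
  -- right derivative; hence it stays `0`.
  have h := image_le_of_deriv_right_le_deriv_boundary (a := 0) (b := (t : ℝ)) (B := fun _ => 0)
    (B' := fun _ => 0) (x := t)
    (f := fun s : ℝ => ‖E s.toNNReal z - F s.toNNReal z‖ ^ 2)
    (Continuous.continuousOn (by fun_prop)) hd (by simp [hE.map_zero, hF.map_zero])
    continuousOn_const (fun s _ => hasDerivWithinAt_const _ _ _)
    (fun s _ => by
      have := hdiss _ _ _ _ (hE.graph_apply hzw s.toNNReal) (hF.graph_apply hzw s.toNNReal)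
      linarith) (by simp)
  simp only [Real.toNNReal_coe] at h
  have h0 : ‖E t z - F t z‖ = 0 := by
    have := sq_nonneg ‖E t z - F t z‖
    exact pow_eq_zero_iff two_ne_zero |>.1 (le_antisymm h this)
  exact sub_eq_zero.1 (norm_eq_zero.1 h0)

end IsSemigroupGeneratedBy

/-- Conjugation of a semigroup by a linear homeomorphism. -/
lemma IsSemigroupGeneratedBy.conj {H K : Type*} [NormedAddCommGroup H] [NormedSpace ℝ H]
    [NormedAddCommGroup K] [NormedSpace ℝ K] (e : H ≃L[ℝ] K) {𝒢 : K → K → Prop}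
    {E : ℝ≥0 → K →L[ℝ] K} (hE : IsSemigroupGeneratedBy 𝒢 E) :
    IsSemigroupGeneratedBy (fun z w => 𝒢 (e z) (e w))
      (fun t => (e.symm : K →L[ℝ] H) ∘L E t ∘L (e : H →L[ℝ] K)) where
  map_zero := by ext z; simp [hE.map_zero]
  map_add s t := by ext z; simp [hE.map_add]
  strong_cont z := by
    simpa [Function.comp_def] using (e.symm.continuous.tendsto _).comp (hE.strong_cont (e z))
  generator z w := by
    rw [← hE.generator]
    constructor
    · intro h
      exact ((e.continuous.tendsto _).comp h).congr fun t => by simp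
    · intro h
      have := (e.symm.continuous.tendsto _).comp h
      simp only [ContinuousLinearEquiv.symm_apply_apply] at this
      exact this.congr fun t => by simp

namespace IsResolvent

variable {K : Type*} [NormedAddCommGroup K] [InnerProductSpace ℂ K] [CompleteSpace K]
  {R : K →L[ℂ] K} (hR : IsResolvent R)
include hR

/-- Dissipativity: `⟨R v, v⟩` is real, so `Im c` drops out and `Re ⟨R v, c (R v - v)⟩ = Re c (‖R v‖²
- ⟨R v, v⟩) ≤ 0`. The domain is the range of `R`, which is dense. -/
theorem eq_heatSemigroup {c : ℂ} (hc : 0 < c.re) {E : ℝ≥0 → K →L[ℝ] K}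
    (hE : IsSemigroupGeneratedBy (resolventGraph R c) E) : E = heatSemigroup R c := by
  let _ : InnerProductSpace ℝ K := InnerProductSpace.complexToReal
  refine IsSemigroupGeneratedBy.unique_of_dissipative (H := K) (𝒢 := resolventGraph R c) ?_ ?_ hE (hR.isSemigroupGeneratedBy_heatSemigroup hc)
  · rintro _ _ _ _ ⟨v₁, rfl, rfl⟩ ⟨v₂, rfl, rfl⟩
    have e : c • (R v₁ - v₁) - c • (R v₂ - v₂) = c • (R (v₁ - v₂) - (v₁ - v₂)) := by
      rw [map_sub, ← smul_sub]; congr 1; abel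
    rw [e, ← map_sub, real_inner_eq_re_inner ℂ, inner_smul_right, inner_sub_right,
      inner_self_eq_norm_sq_to_K]
    set v := v₁ - v₂
    have h1 := hR.norm_sq_le v
    have h2 : (inner ℂ (R v) v).im = 0 := by
      have := (hR.isSelfAdjoint.isSymmetric).im_inner_apply_self v
      simpa using this
    simp only [RCLike.re_to_complex, Complex.mul_re, Complex.sub_re, Complex.sub_im, h2]
    have h3 : ((((‖R v‖ : ℝ) : ℂ)) ^ 2).re = ‖R v‖ ^ 2 := by
      rw [← Complex.ofReal_pow, Complex.ofReal_re]
    have h4 : ((((‖R v‖ : ℝ) : ℂ)) ^ 2).im = 0 := by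
      rw [← Complex.ofReal_pow, Complex.ofReal_im]
    simp only [Complex.coe_algebraMap, h3, h4]
    nlinarith
  · refine hR.denseRange.mono ?_
    rintro _ ⟨v, rfl⟩
    exact ⟨_, v, rfl, rfl⟩

end IsResolvent

end Uniqueness

/-! ### The Dirichlet resolvent as a compressed orthogonal projection. -/

section DirichletResolvent

variable {d : ℕ} (Ω : Opens (Eucl d))

/-- Lebesgue measure on `Ω`. -/
abbrev volΩ : Measure (Eucl d) := volume.restrict (Ω : Set (Eucl d))

variable {Ω}

lemma gradient_testFunction_eq (φ : 𝓓(Ω, ℝ)) :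
    gradient φ = (InnerProductSpace.toDual ℝ (Eucl d)).symm ∘ fderiv ℝ φ := rfl

lemma continuous_gradient_testFunction (φ : 𝓓(Ω, ℝ)) : Continuous (gradient φ) := by
  rw [gradient_testFunction_eq]
  exact (LinearIsometryEquiv.continuous _).comp (φ.contDiff.continuous_fderiv (by simp))

lemma hasCompactSupport_gradient_testFunction (φ : 𝓓(Ω, ℝ)) : HasCompactSupport (gradient φ) := by
  rw [gradient_testFunction_eq]
  exact (φ.hasCompactSupport.fderiv ℝ).comp_left (map_zero _)

lemma memLp_testFunction (φ : 𝓓(Ω, ℝ)) : MemLp φ 2 (volΩ Ω) :=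
  φ.continuous.memLp_of_hasCompactSupport φ.hasCompactSupport

lemma memLp_gradient_testFunction (φ : 𝓓(Ω, ℝ)) : MemLp (gradient φ) 2 (volΩ Ω) :=
  (continuous_gradient_testFunction φ).memLp_of_hasCompactSupport
    (hasCompactSupport_gradient_testFunction φ)

lemma differentiableAt_testFunction (φ : 𝓓(Ω, ℝ)) (x : Eucl d) : DifferentiableAt ℝ φ x :=
  (φ.contDiff.differentiable (by simp)) x

lemma gradient_testFunction_add (φ ψ : 𝓓(Ω, ℝ)) :
    gradient (φ + ψ : 𝓓(Ω, ℝ)) = gradient φ + gradient ψ := by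
  funext x
  have e : ((φ + ψ : 𝓓(Ω, ℝ)) : Eucl d → ℝ) = (φ : Eucl d → ℝ) + ψ := by ext; simp
  simp only [gradient, Pi.add_apply, e]
  rw [fderiv_add (differentiableAt_testFunction φ x) (differentiableAt_testFunction ψ x), map_add]

lemma gradient_testFunction_smul (c : ℝ) (φ : 𝓓(Ω, ℝ)) :
    gradient (c • φ : 𝓓(Ω, ℝ)) = c • gradient φ := by
  funext x
  have e : ((c • φ : 𝓓(Ω, ℝ)) : Eucl d → ℝ) = c • (φ : Eucl d → ℝ) := by ext; simp
  simp only [gradient, Pi.smul_apply, e]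
  rw [fderiv_const_smul (differentiableAt_testFunction φ x)]
  simp

variable (Ω) in
/-- The ambient Hilbert space `L²(Ω) × L²(Ω; ℝ^d)` of pairs `(u, ∇u)`. -/
abbrev GradPair : Type := WithLp 2 (L2Scal Ω × L2Vec Ω d)

variable (Ω) in
/-- The map `φ ↦ (φ, ∇φ)` on test functions. -/
def testPair : 𝓓(Ω, ℝ) →ₗ[ℝ] GradPair Ω where
  toFun φ := WithLp.toLp 2 ((memLp_testFunction φ).toLp φ,
    (memLp_gradient_testFunction φ).toLp (gradient φ))
  map_add' φ ψ := by
    rw [← WithLp.toLp_add, Prod.mk_add_mk, ← MemLp.toLp_add, ← MemLp.toLp_add]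
    congr 2
    exact MemLp.toLp_congr _ _ (by rw [gradient_testFunction_add])
  map_smul' c φ := by
    rw [RingHom.id_apply, ← WithLp.toLp_smul, Prod.smul_mk, ← MemLp.toLp_const_smul,
      ← MemLp.toLp_const_smul]
    congr 2
    exact MemLp.toLp_congr _ _ (by rw [gradient_testFunction_smul])

variable (Ω) in
/-- The space `H₀¹(Ω)`, as the closure of the pairs `(φ, ∇φ)`. -/
def gradGraph : Submodule ℝ (GradPair Ω) := (LinearMap.range (testPair Ω)).topologicalClosure

instance : CompleteSpace (gradGraph Ω) :=
  (Submodule.isClosed_topologicalClosure _).completeSpace_coe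

lemma tendsto_testPair_iff (φ : ℕ → 𝓓(Ω, ℝ)) (u : L2Scal Ω) (G : L2Vec Ω d) :
    Tendsto (fun n => testPair Ω (φ n)) atTop (𝓝 (WithLp.toLp 2 (u, G))) ↔
    Tendsto (fun n => eLpNorm (fun x => φ n x - u x) 2 (volΩ Ω)) atTop (𝓝 0) ∧
    Tendsto (fun n => eLpNorm (fun x => gradient (φ n) x - G x) 2 (volΩ Ω)) atTop (𝓝 0) := by
  have h1 : Tendsto (fun n => testPair Ω (φ n)) atTop (𝓝 (WithLp.toLp 2 (u, G))) ↔
      Tendsto (fun n => ((memLp_testFunction (φ n)).toLp (φ n),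
        (memLp_gradient_testFunction (φ n)).toLp (gradient (φ n)))) atTop (𝓝 (u, G)) := by
    let e := WithLp.prodContinuousLinearEquiv 2 ℝ (L2Scal Ω) (L2Vec Ω d)
    constructor
    · exact fun h => (e.continuous.tendsto _).comp h
    · exact fun h => (e.symm.continuous.tendsto _).comp h
  rw [h1, Prod.tendsto_iff, Lp.tendsto_Lp_iff_tendsto_eLpNorm', Lp.tendsto_Lp_iff_tendsto_eLpNorm']
  refine and_congr (tendsto_congr fun n => eLpNorm_congr_ae ?_)
    (tendsto_congr fun n => eLpNorm_congr_ae ?_)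
  · filter_upwards [(memLp_testFunction (φ n)).coeFn_toLp] with x hx
    simp [hx]
  · filter_upwards [(memLp_gradient_testFunction (φ n)).coeFn_toLp] with x hx
    simp [hx]

lemma isH10WithGradient_iff (u : L2Scal Ω) (G : L2Vec Ω d) :
    IsH10WithGradient Ω u G ↔ WithLp.toLp 2 (u, G) ∈ gradGraph Ω := by
  simp only [IsH10WithGradient, ← tendsto_testPair_iff]
  rw [gradGraph, ← SetLike.mem_coe, Submodule.topologicalClosure_coe, mem_closure_iff_seq_limit]
  constructor
  · rintro ⟨φ, h⟩
    exact ⟨_, fun n => ⟨φ n, rfl⟩, h⟩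
  · rintro ⟨x, hx, h⟩
    choose φ hφ using hx
    exact ⟨φ, by simpa only [hφ] using h⟩

lemma mem_gradGraph_orthogonal_iff (x : GradPair Ω) :
    x ∈ (gradGraph Ω)ᗮ ↔ ∀ φ, inner ℝ x (testPair Ω φ) = 0 := by
  rw [gradGraph, Submodule.orthogonal_closure, Submodule.mem_orthogonal']
  simp

lemma inner_testPair (u : L2Scal Ω) (G : L2Vec Ω d) (φ : 𝓓(Ω, ℝ)) :
    inner ℝ (WithLp.toLp 2 (u, G) : GradPair Ω) (testPair Ω φ) =
      (∫ x in (Ω : Set (Eucl d)), u x * φ x) +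
        ∫ x in (Ω : Set (Eucl d)), inner ℝ (G x) (gradient φ x) := by
  rw [WithLp.prod_inner_apply]
  simp only [testPair, LinearMap.coe_mk, AddHom.coe_mk, L2.inner_def]
  congr 1
  · refine integral_congr_ae ?_
    filter_upwards [(memLp_testFunction φ).coeFn_toLp] with x hx
    simp [hx, mul_comm]
  · refine integral_congr_ae ?_
    filter_upwards [(memLp_gradient_testFunction φ).coeFn_toLp] with x hx
    simp [hx]

variable (Ω) in
/-- The inclusion `v ↦ (v, 0)`. -/
def inlPair : L2Scal Ω →L[ℝ] GradPair Ω :=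
  ((WithLp.prodContinuousLinearEquiv 2 ℝ (L2Scal Ω) (L2Vec Ω d)).symm :
    L2Scal Ω × L2Vec Ω d →L[ℝ] GradPair Ω) ∘L ContinuousLinearMap.inl ℝ _ _

lemma inlPair_apply (v : L2Scal Ω) : inlPair Ω v = WithLp.toLp 2 (v, 0) := rfl

lemma inner_inlPair (x : GradPair Ω) (v : L2Scal Ω) :
    inner ℝ x (inlPair Ω v) = inner ℝ x.fst v := by
  rw [WithLp.prod_inner_apply, inlPair_apply]
  simp

variable (Ω) in
/-- The resolvent `(1 - Δ)⁻¹` of the Dirichlet Laplacian on `L²(Ω; ℝ)`. -/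
def dirichletResolvent : L2Scal Ω →L[ℝ] L2Scal Ω :=
  WithLp.fstL 2 ℝ (L2Scal Ω) (L2Vec Ω d) ∘L (gradGraph Ω).starProjection ∘L inlPair Ω

lemma dirichletResolvent_apply (v : L2Scal Ω) :
    dirichletResolvent Ω v = ((gradGraph Ω).starProjection (inlPair Ω v)).fst := rfl

/-- The weak equation says that `(u - f, 0) - (u, G) = -(f, G)` is orthogonal to every `(φ, ∇φ)`.
Together with `(u, G) ∈ gradGraph Ω`, this characterizes `(u, G)` as the orthogonal projection of
`(u - f, 0)`. -/
theorem isDirichletLaplacian_iff (u f : L2Scal Ω) :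
    IsDirichletLaplacian Ω u f ↔ u = dirichletResolvent Ω (u - f) := by
  have key : ∀ G : L2Vec Ω d, (∀ φ : 𝓓(Ω, ℝ),
      ∫ x in (Ω : Set (Eucl d)), inner ℝ (G x) (gradient φ x)
        = - ∫ x in (Ω : Set (Eucl d)), f x * φ x) ↔
      inlPair Ω (u - f) - WithLp.toLp 2 (u, G) ∈ (gradGraph Ω)ᗮ := by
    intro G
    rw [mem_gradGraph_orthogonal_iff]
    refine forall_congr' fun φ => ?_
    have e : inlPair Ω (u - f) - WithLp.toLp 2 (u, G) = - (WithLp.toLp 2 (f, G) : GradPair Ω) := by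
      rw [inlPair_apply, ← WithLp.toLp_sub, ← WithLp.toLp_neg]
      congr 1
      simp
    rw [e, inner_neg_left, inner_testPair, neg_eq_zero, add_comm, add_eq_zero_iff_eq_neg]
  simp only [IsDirichletLaplacian, key, isH10WithGradient_iff]
  constructor
  · rintro ⟨G, h1, h2⟩
    rw [dirichletResolvent_apply, Submodule.eq_starProjection_of_mem_orthogonal h1 h2]
    rfl
  · intro h
    set p := (gradGraph Ω).starProjection (inlPair Ω (u - f)) with hp
    have e : (WithLp.toLp 2 (u, p.snd) : GradPair Ω) = p := by
      conv_lhs => rw [h]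
      rfl
    refine ⟨p.snd, ?_, ?_⟩
    · rw [e]
      exact Submodule.starProjection_apply_mem _ _
    · rw [e]
      exact Submodule.sub_starProjection_mem_orthogonal _

lemma inner_dirichletResolvent_left (v w : L2Scal Ω) :
    inner ℝ (dirichletResolvent Ω v) w = inner ℝ v (dirichletResolvent Ω w) := by
  rw [dirichletResolvent_apply, ← inner_inlPair, Submodule.inner_starProjection_left_eq_right,
    real_inner_comm, inner_inlPair, real_inner_comm, dirichletResolvent_apply]

/-- An orthogonal projection `P` satisfies `⟨P x, x⟩ = ‖P x‖²`. Dropping the gradient component of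
the norm then gives the bound required by `IsResolvent`. -/
lemma norm_starProjection_inlPair_sq (v : L2Scal Ω) :
    ‖(gradGraph Ω).starProjection (inlPair Ω v)‖ ^ 2 = inner ℝ (dirichletResolvent Ω v) v := by
  rw [dirichletResolvent_apply, ← inner_inlPair]
  exact ((gradGraph Ω).re_inner_starProjection_eq_normSq (inlPair Ω v)).symm

lemma norm_dirichletResolvent_sq_le (v : L2Scal Ω) :
    ‖dirichletResolvent Ω v‖ ^ 2 ≤ inner ℝ (dirichletResolvent Ω v) v := by
  rw [← norm_starProjection_inlPair_sq, WithLp.prod_norm_sq_eq_of_L2, dirichletResolvent_apply]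
  exact le_add_of_nonneg_right (sq_nonneg _)

lemma eq_zero_of_integral_mul_testFunction (v : L2Scal Ω)
    (h : ∀ φ : 𝓓(Ω, ℝ), ∫ x in (Ω : Set (Eucl d)), v x * φ x = 0) :
    v = 0 := by
  have hloc : LocallyIntegrable v (volΩ Ω) := (Lp.memLp v).locallyIntegrable (by norm_num)
  have h0 := Ω.isOpen.ae_eq_zero_of_integral_contDiff_smul_eq_zero (μ := volΩ Ω)
    (hloc.locallyIntegrableOn _) fun g hg hgc hgs => by
      simpa [mul_comm] using h ⟨g, hg, hgc, hgs⟩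
  rw [Lp.eq_zero_iff_ae_eq_zero]
  filter_upwards [h0, ae_restrict_mem Ω.isOpen.measurableSet] with x hx hxm using hx hxm

/-- By the norm identity the whole projection of `(v, 0)` vanishes, so `v` is orthogonal to all test
functions. -/
lemma dirichletResolvent_injective {v : L2Scal Ω} (hv : dirichletResolvent Ω v = 0) : v = 0 := by
  have h := norm_starProjection_inlPair_sq v
  rw [hv, inner_zero_left, sq_eq_zero_iff, norm_eq_zero,
    Submodule.starProjection_apply_eq_zero_iff, mem_gradGraph_orthogonal_iff] at h
  refine eq_zero_of_integral_mul_testFunction v fun φ => ?_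
  have h1 := h φ
  rw [inlPair_apply, inner_testPair] at h1
  have h2 : ∫ x in (Ω : Set (Eucl d)), inner ℝ ((0 : L2Vec Ω d) x) (gradient φ x) = 0 := by
    refine integral_eq_zero_of_ae ?_
    filter_upwards [Lp.coeFn_zero (Eucl d) 2 (volΩ Ω)] with x hx
    rw [hx, Pi.zero_apply, inner_zero_left, Pi.zero_apply]
  rwa [h2, add_zero] at h1

end DirichletResolvent

/-! ### Complexification of `L²` and operators preserving real functions. -/

section Complexification

variable {X : Type*} [MeasurableSpace X] (μ : Measure X)

/-- The complex Hilbert space `L²(μ; ℂ)`, whose real structure is the one obtained by restriction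
of scalars. -/
def L2Cplx : Type _ := Lp ℂ 2 μ

instance : NormedAddCommGroup (L2Cplx μ) := inferInstanceAs (NormedAddCommGroup (Lp ℂ 2 μ))
instance : InnerProductSpace ℂ (L2Cplx μ) := inferInstanceAs (InnerProductSpace ℂ (Lp ℂ 2 μ))
instance : CompleteSpace (L2Cplx μ) := inferInstanceAs (CompleteSpace (Lp ℂ 2 μ))

/-- Real functions as complex functions. -/
def ofRealL : Lp ℝ 2 μ →L[ℝ] L2Cplx μ where
  toFun := Complex.ofRealCLM.compLpL 2 μ
  map_add' := map_add (Complex.ofRealCLM.compLpL 2 μ)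
  map_smul' := map_smul (Complex.ofRealCLM.compLpL 2 μ)
  cont := (Complex.ofRealCLM.compLpL 2 μ).continuous

/-- The real part. -/
def reL : L2Cplx μ →L[ℝ] Lp ℝ 2 μ where
  toFun := Complex.reCLM.compLpL 2 μ
  map_add' := map_add (Complex.reCLM.compLpL 2 μ)
  map_smul' := map_smul (Complex.reCLM.compLpL 2 μ)
  cont := (Complex.reCLM.compLpL 2 μ).continuous

/-- The imaginary part. -/
def imL : L2Cplx μ →L[ℝ] Lp ℝ 2 μ where
  toFun := Complex.imCLM.compLpL 2 μ
  map_add' := map_add (Complex.imCLM.compLpL 2 μ)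
  map_smul' := map_smul (Complex.imCLM.compLpL 2 μ)
  cont := (Complex.imCLM.compLpL 2 μ).continuous

/-- `L²(μ; ℝ²)` is `L²(μ; ℂ)`. -/
def eucl2EquivCplx : Lp (Eucl 2) 2 μ ≃L[ℝ] L2Cplx μ where
  toFun := (Complex.orthonormalBasisOneI.repr.symm.toContinuousLinearEquiv :
    Eucl 2 →L[ℝ] ℂ).compLpL 2 μ
  invFun := (Complex.orthonormalBasisOneI.repr.toContinuousLinearEquiv : ℂ →L[ℝ] Eucl 2).compLpL 2 μ
  map_add' := map_add ((Complex.orthonormalBasisOneI.repr.symm.toContinuousLinearEquiv :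
    Eucl 2 →L[ℝ] ℂ).compLpL 2 μ)
  map_smul' := map_smul ((Complex.orthonormalBasisOneI.repr.symm.toContinuousLinearEquiv :
    Eucl 2 →L[ℝ] ℂ).compLpL 2 μ)
  left_inv z := by
    apply Lp.ext
    refine (ContinuousLinearMap.coeFn_compLpL _ _).trans ?_
    filter_upwards [ContinuousLinearMap.coeFn_compLpL (p := 2) (μ := μ)
      (Complex.orthonormalBasisOneI.repr.symm.toContinuousLinearEquiv : Eucl 2 →L[ℝ] ℂ) z] with x hx
    rw [hx]
    exact Complex.orthonormalBasisOneI.repr.apply_symm_apply _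
  right_inv z := by
    apply Lp.ext
    refine (ContinuousLinearMap.coeFn_compLpL _ _).trans ?_
    filter_upwards [ContinuousLinearMap.coeFn_compLpL (p := 2) (μ := μ)
      (Complex.orthonormalBasisOneI.repr.toContinuousLinearEquiv : ℂ →L[ℝ] Eucl 2) z] with x hx
    rw [hx]
    exact Complex.orthonormalBasisOneI.repr.symm_apply_apply _
  continuous_toFun := ((Complex.orthonormalBasisOneI.repr.symm.toContinuousLinearEquiv :
    Eucl 2 →L[ℝ] ℂ).compLpL 2 μ).continuous
  continuous_invFun := ((Complex.orthonormalBasisOneI.repr.toContinuousLinearEquiv :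
    ℂ →L[ℝ] Eucl 2).compLpL 2 μ).continuous

variable {μ}

lemma reL_eucl2EquivCplx (z : Lp (Eucl 2) 2 μ) :
    reL μ (eucl2EquivCplx μ z) = (EuclideanSpace.proj 0 : Eucl 2 →L[ℝ] ℝ).compLpL 2 μ z := by
  apply Lp.ext
  refine (ContinuousLinearMap.coeFn_compLpL Complex.reCLM _).trans ?_
  filter_upwards [ContinuousLinearMap.coeFn_compLpL (p := 2) (μ := μ)
      (Complex.orthonormalBasisOneI.repr.symm.toContinuousLinearEquiv : Eucl 2 →L[ℝ] ℂ) z,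
    ContinuousLinearMap.coeFn_compLpL (p := 2) (μ := μ)
      (EuclideanSpace.proj 0 : Eucl 2 →L[ℝ] ℝ) z] with x h1 h2
  refine (congrArg Complex.reCLM h1).trans ?_
  rw [h2]
  simp

lemma imL_eucl2EquivCplx (z : Lp (Eucl 2) 2 μ) :
    imL μ (eucl2EquivCplx μ z) = (EuclideanSpace.proj 1 : Eucl 2 →L[ℝ] ℝ).compLpL 2 μ z := by
  apply Lp.ext
  refine (ContinuousLinearMap.coeFn_compLpL Complex.imCLM _).trans ?_
  filter_upwards [ContinuousLinearMap.coeFn_compLpL (p := 2) (μ := μ)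
      (Complex.orthonormalBasisOneI.repr.symm.toContinuousLinearEquiv : Eucl 2 →L[ℝ] ℂ) z,
    ContinuousLinearMap.coeFn_compLpL (p := 2) (μ := μ)
      (EuclideanSpace.proj 1 : Eucl 2 →L[ℝ] ℝ) z] with x h1 h2
  refine (congrArg Complex.imCLM h1).trans ?_
  rw [h2]
  simp

lemma reL_smul (c : ℂ) (u : L2Cplx μ) : reL μ (c • u) = c.re • reL μ u - c.im • imL μ u := by
  apply Lp.ext
  refine (ContinuousLinearMap.coeFn_compLpL Complex.reCLM _).trans ?_
  filter_upwards [Lp.coeFn_smul c (show Lp ℂ 2 μ from u),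
    Lp.coeFn_sub (c.re • reL μ u) (c.im • imL μ u), Lp.coeFn_smul c.re (reL μ u),
    Lp.coeFn_smul c.im (imL μ u), ContinuousLinearMap.coeFn_compLpL (p := 2) (μ := μ)
      Complex.reCLM u, ContinuousLinearMap.coeFn_compLpL (p := 2) (μ := μ)
      Complex.imCLM u] with x h1 h2 h3 h4 h5 h6
  refine (congrArg Complex.reCLM h1).trans ?_
  rw [h2, Pi.sub_apply, h3, h4, Pi.smul_apply, Pi.smul_apply, Pi.smul_apply]
  refine Eq.trans ?_ (congrArg₂ (fun s t : ℝ => c.re • s - c.im • t) h5.symm h6.symm)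
  simp

lemma imL_smul (c : ℂ) (u : L2Cplx μ) : imL μ (c • u) = c.re • imL μ u + c.im • reL μ u := by
  apply Lp.ext
  refine (ContinuousLinearMap.coeFn_compLpL Complex.imCLM _).trans ?_
  filter_upwards [Lp.coeFn_smul c (show Lp ℂ 2 μ from u),
    Lp.coeFn_add (c.re • imL μ u) (c.im • reL μ u), Lp.coeFn_smul c.re (imL μ u),
    Lp.coeFn_smul c.im (reL μ u), ContinuousLinearMap.coeFn_compLpL (p := 2) (μ := μ)
      Complex.reCLM u, ContinuousLinearMap.coeFn_compLpL (p := 2) (μ := μ)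
      Complex.imCLM u] with x h1 h2 h3 h4 h5 h6
  refine (congrArg Complex.imCLM h1).trans ?_
  rw [h2, Pi.add_apply, h3, h4, Pi.smul_apply, Pi.smul_apply, Pi.smul_apply]
  refine Eq.trans ?_ (congrArg₂ (fun s t : ℝ => c.re • s + c.im • t) h6.symm h5.symm)
  simp

@[simp] lemma reL_ofRealL (h : Lp ℝ 2 μ) : reL μ (ofRealL μ h) = h := by
  apply Lp.ext
  refine (ContinuousLinearMap.coeFn_compLpL Complex.reCLM _).trans ?_
  filter_upwards [ContinuousLinearMap.coeFn_compLpL (p := 2) (μ := μ) Complex.ofRealCLM h] with x h1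
  exact (congrArg Complex.reCLM h1).trans (by simp)

@[simp] lemma imL_ofRealL (h : Lp ℝ 2 μ) : imL μ (ofRealL μ h) = 0 := by
  apply Lp.ext
  refine (ContinuousLinearMap.coeFn_compLpL Complex.imCLM _).trans ?_
  filter_upwards [ContinuousLinearMap.coeFn_compLpL (p := 2) (μ := μ) Complex.ofRealCLM h,
    Lp.coeFn_zero ℝ 2 μ] with x h1 h2
  rw [h2]
  exact (congrArg Complex.imCLM h1).trans (by simp)

lemma L2Cplx.ext {u w : L2Cplx μ} (hre : reL μ u = reL μ w) (him : imL μ u = imL μ w) : u = w := by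
  have key : (show Lp ℂ 2 μ from u) = w := by
    apply Lp.ext
    filter_upwards [ContinuousLinearMap.coeFn_compLpL (p := 2) (μ := μ) Complex.reCLM u,
      ContinuousLinearMap.coeFn_compLpL (p := 2) (μ := μ) Complex.imCLM u,
      ContinuousLinearMap.coeFn_compLpL (p := 2) (μ := μ) Complex.reCLM w,
      ContinuousLinearMap.coeFn_compLpL (p := 2) (μ := μ) Complex.imCLM w] with x h1 h2 h3 h4
    refine Complex.ext ?_ ?_
    · exact (h1.symm.trans (congrArg (fun f : Lp ℝ 2 μ => f x) hre)).trans h3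
    · exact (h2.symm.trans (congrArg (fun f : Lp ℝ 2 μ => f x) him)).trans h4
  exact key

lemma eq_ofRealL_add (u : L2Cplx μ) :
    u = ofRealL μ (reL μ u) + Complex.I • ofRealL μ (imL μ u) := by
  apply L2Cplx.ext <;> simp [reL_smul, imL_smul]

lemma inner_ofRealL (g h : Lp ℝ 2 μ) :
    inner ℂ (ofRealL μ g) (ofRealL μ h) = ((inner ℝ g h : ℝ) : ℂ) := by
  rw [L2.inner_def, ← integral_complex_ofReal]
  refine (L2.inner_def (𝕜 := ℂ) _ _).trans (integral_congr_ae ?_)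
  filter_upwards [ContinuousLinearMap.coeFn_compLpL (p := 2) (μ := μ) Complex.ofRealCLM g,
    ContinuousLinearMap.coeFn_compLpL (p := 2) (μ := μ) Complex.ofRealCLM h] with x h1 h2
  refine (congrArg₂ (fun s t : ℂ => inner ℂ s t) h1 h2).trans ?_
  simp

lemma inner_eq_re_im (u w : L2Cplx μ) :
    inner ℂ u w = ((inner ℝ (reL μ u) (reL μ w) + inner ℝ (imL μ u) (imL μ w) : ℝ) : ℂ) +
      ((inner ℝ (reL μ u) (imL μ w) - inner ℝ (imL μ u) (reL μ w) : ℝ) : ℂ) * Complex.I := by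
  conv_lhs => rw [eq_ofRealL_add u, eq_ofRealL_add w]
  simp only [inner_add_left, inner_add_right, inner_smul_left, inner_smul_right, inner_ofRealL,
    Complex.conj_I]
  push_cast
  linear_combination (-(inner ℝ (imL μ u) (imL μ w) : ℝ) : ℂ) * Complex.I_sq

lemma inner_re (u w : L2Cplx μ) : (inner ℂ u w).re =
    inner ℝ (reL μ u) (reL μ w) + inner ℝ (imL μ u) (imL μ w) := by
  rw [inner_eq_re_im]; simp

lemma norm_sq_eq_re_im (u : L2Cplx μ) : ‖u‖ ^ 2 = ‖reL μ u‖ ^ 2 + ‖imL μ u‖ ^ 2 := by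
  rw [← real_inner_self_eq_norm_sq (reL μ u), ← real_inner_self_eq_norm_sq (imL μ u), ← inner_re]
  exact (inner_self_eq_norm_sq (𝕜 := ℂ) u).symm

/-- The complex-linear extension of a real operator. -/
def complexify (T : Lp ℝ 2 μ →L[ℝ] Lp ℝ 2 μ) : L2Cplx μ →L[ℂ] L2Cplx μ where
  toFun u := ofRealL μ (T (reL μ u)) + Complex.I • ofRealL μ (T (imL μ u))
  map_add' u w := by simp only [map_add, smul_add]; abel
  map_smul' c u := by
    apply L2Cplx.ext <;> simp [reL_smul, imL_smul] <;> abel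
  cont := by fun_prop

@[simp] lemma reL_complexify (T : Lp ℝ 2 μ →L[ℝ] Lp ℝ 2 μ) (u : L2Cplx μ) :
    reL μ (complexify T u) = T (reL μ u) := by
  change reL μ (ofRealL μ (T (reL μ u)) + Complex.I • ofRealL μ (T (imL μ u))) = _
  simp [reL_smul]

@[simp] lemma imL_complexify (T : Lp ℝ 2 μ →L[ℝ] Lp ℝ 2 μ) (u : L2Cplx μ) :
    imL μ (complexify T u) = T (imL μ u) := by
  change imL μ (ofRealL μ (T (reL μ u)) + Complex.I • ofRealL μ (T (imL μ u))) = _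
  simp [imL_smul]

theorem isResolvent_complexify {T : Lp ℝ 2 μ →L[ℝ] Lp ℝ 2 μ}
    (hsymm : ∀ v w, inner ℝ (T v) w = inner ℝ v (T w))
    (hle : ∀ v, ‖T v‖ ^ 2 ≤ inner ℝ (T v) v) (hinj : ∀ v, T v = 0 → v = 0) :
    IsResolvent (complexify T) where
  isSelfAdjoint := by
    rw [ContinuousLinearMap.isSelfAdjoint_iff_isSymmetric]
    intro u w
    simp only [ContinuousLinearMap.coe_coe, inner_eq_re_im, reL_complexify, imL_complexify, hsymm]
  norm_sq_le u := by
    rw [inner_re, norm_sq_eq_re_im, reL_complexify, imL_complexify]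
    exact add_le_add (hle _) (hle _)
  injective u hu := by
    have h1 := congrArg (reL μ) hu
    have h2 := congrArg (imL μ) hu
    rw [reL_complexify, map_zero] at h1
    rw [imL_complexify, map_zero] at h2
    apply L2Cplx.ext
    · rw [hinj _ h1, map_zero]
    · rw [hinj _ h2, map_zero]

variable (μ) in
/-- The operators on `L²(μ; ℂ)` which map real functions to real functions. -/
def realOperators : StarSubalgebra ℝ (L2Cplx μ →L[ℂ] L2Cplx μ) where
  carrier := {T | ∀ h, imL μ (T (ofRealL μ h)) = 0}
  mul_mem' {S T} hS hT h := by
    have e : T (ofRealL μ h) = ofRealL μ (reL μ (T (ofRealL μ h))) := by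
      apply L2Cplx.ext <;> simp [hT h]
    rw [mul_apply_eq_comp, e]
    exact hS _
  add_mem' {S T} hS hT h := by
    rw [add_apply, map_add, hS h, hT h, add_zero]
  algebraMap_mem' r h := by
    simp [Algebra.algebraMap_eq_smul_one]
  star_mem' {T} hT h := by
    -- Take imaginary parts in `⟨g, T* h⟩ = ⟨T g, h⟩` for real `g` and `h`; the right side is real
    -- because `T g` is.
    refine ext_inner_left ℝ fun g => ?_
    have h1 := congrArg Complex.im
      (ContinuousLinearMap.adjoint_inner_right T (ofRealL μ g) (ofRealL μ h))
    rw [inner_eq_re_im, inner_eq_re_im] at h1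
    simpa [hT g, ContinuousLinearMap.star_eq_adjoint] using h1

instance : IsClosed (realOperators μ : Set (L2Cplx μ →L[ℂ] L2Cplx μ)) := by
  have e : (realOperators μ : Set (L2Cplx μ →L[ℂ] L2Cplx μ)) =
      ⋂ h, {T | imL μ (T (ofRealL μ h)) = 0} := by
    ext T
    simp only [Set.mem_iInter]
    rfl
  rw [e]
  exact isClosed_iInter fun h => isClosed_eq (by fun_prop) continuous_const

/-- As `resolventExp s` is real on the spectrum, the complex functional calculus reduces to the real
one, which stays in any closed real star subalgebra containing `R`. -/
lemma heatOp_mem_realOperators {R : L2Cplx μ →L[ℂ] L2Cplx μ} (hR : IsResolvent R)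
    (hreal : R ∈ realOperators μ) (s : ℝ) : heatOp R s ∈ realOperators μ := by
  unfold heatOp
  split_ifs
  · exact one_mem _
  · rw [cfc_complex_eq_real R (fun z hz => ?_) hR.isSelfAdjoint]
    · exact cfc_mem (𝕜 := ℝ) (𝕜' := ℝ) _ hreal
    · obtain ⟨r, -, -, rfl⟩ := hR.spectrum_subset hz
      simp only [resolventExp]
      split_ifs
      · simp
      · simp [← Complex.exp_conj]

lemma complexify_mem_realOperators (T : Lp ℝ 2 μ →L[ℝ] Lp ℝ 2 μ) :
    complexify T ∈ realOperators μ := fun h => by simp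

end Complexification

/-! ### The coupled system and its unobservable states. -/

section CoupledSystem

variable {d : ℕ} (Ω : Opens (Eucl d))

/-- The complexified resolvent of the Dirichlet Laplacian. -/
def complexResolvent : L2Cplx (volΩ Ω) →L[ℂ] L2Cplx (volΩ Ω) := complexify (dirichletResolvent Ω)

lemma isResolvent_complexResolvent : IsResolvent (complexResolvent Ω) :=
  isResolvent_complexify inner_dirichletResolvent_left norm_dirichletResolvent_sq_le
    fun _ => dirichletResolvent_injective

/-- The identification `(z₁, z₂) ↦ z₁ + i z₂`. -/
abbrev toCplx : L2Vec Ω 2 ≃L[ℝ] L2Cplx (volΩ Ω) := eucl2EquivCplx (volΩ Ω)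

lemma reL_toCplx (z : L2Vec Ω 2) : reL _ (toCplx Ω z) = comp Ω 0 z := reL_eucl2EquivCplx z

lemma imL_toCplx (z : L2Vec Ω 2) : imL _ (toCplx Ω z) = comp Ω 1 z := imL_eucl2EquivCplx z

/-- Under `(z₁, z₂) ↦ z₁ + i z₂`, the operator matrix becomes `(a + i b) Δ`. -/
theorem opA_iff (a b : ℝ) (z w : L2Vec Ω 2) :
    opA Ω a b z w ↔ resolventGraph (complexResolvent Ω) ⟨a, b⟩ (toCplx Ω z) (toCplx Ω w) := by
  simp only [opA, isDirichletLaplacian_iff, ← reL_toCplx, ← imL_toCplx]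
  generalize toCplx Ω z = z
  generalize toCplx Ω w = w
  constructor
  · rintro ⟨f₁, f₂, h1, h2, h3, h4⟩
    -- This is `(1 - Δ) z`, the preimage of `z` under the resolvent.
    set v := z - (ofRealL _ f₁ + Complex.I • ofRealL _ f₂) with hv
    have hz : z = complexResolvent Ω v := by
      apply L2Cplx.ext
      · simpa [hv, complexResolvent, reL_smul] using h1
      · simpa [hv, complexResolvent, imL_smul] using h2
    refine ⟨v, hz, ?_⟩
    rw [← hz, hv, sub_sub_cancel]
    apply L2Cplx.ext
    · simp [h3, reL_smul, imL_smul, sub_eq_add_neg]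
    · rw [h4, imL_smul, add_comm]
      simp [reL_smul, imL_smul]
  · rintro ⟨v, rfl, rfl⟩
    refine ⟨reL _ (complexResolvent Ω v - v), imL _ (complexResolvent Ω v - v), ?_, ?_, ?_, ?_⟩
    · simp [complexResolvent]
    · simp [complexResolvent]
    · rw [reL_smul]
    · rw [imL_smul, add_comm]

/-- The semigroup on `L²(Ω; ℝ²)` generated by the operator matrix. -/
def coupledSemigroup (a b : ℝ) (t : ℝ≥0) : L2Vec Ω 2 →L[ℝ] L2Vec Ω 2 :=
  ((toCplx Ω).symm : L2Cplx (volΩ Ω) →L[ℝ] L2Vec Ω 2) ∘L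
    heatSemigroup (complexResolvent Ω) ⟨a, b⟩ t ∘L (toCplx Ω : L2Vec Ω 2 →L[ℝ] L2Cplx (volΩ Ω))

lemma toCplx_coupledSemigroup (a b : ℝ) (t : ℝ≥0) (z : L2Vec Ω 2) :
    toCplx Ω (coupledSemigroup Ω a b t z) =
      heatOp (complexResolvent Ω) (⟨a, b⟩ * (t : ℝ)) (toCplx Ω z) :=
  (toCplx Ω).apply_symm_apply _

lemma opA_eq (a b : ℝ) : opA Ω a b = fun z w =>
    resolventGraph (complexResolvent Ω) ⟨a, b⟩ (toCplx Ω z) (toCplx Ω w) := by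
  funext z w
  exact propext (opA_iff Ω a b z w)

theorem isSemigroupGeneratedBy_coupledSemigroup {a b : ℝ} (ha : 0 < a) :
    IsSemigroupGeneratedBy (opA Ω a b) (coupledSemigroup Ω a b) := by
  rw [opA_eq Ω a b]
  exact ((isResolvent_complexResolvent Ω).isSemigroupGeneratedBy_heatSemigroup
    (c := ⟨a, b⟩) ha).conj (toCplx Ω)

theorem eq_coupledSemigroup {a b : ℝ} (ha : 0 < a) {E : ℝ≥0 → L2Vec Ω 2 →L[ℝ] L2Vec Ω 2}
    (hE : IsSemigroupGeneratedBy (opA Ω a b) E) : E = coupledSemigroup Ω a b := by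
  have h := hE.conj (toCplx Ω).symm
  simp only [opA_eq Ω a b, ContinuousLinearEquiv.apply_symm_apply] at h
  have h2 := (isResolvent_complexResolvent Ω).eq_heatSemigroup (c := ⟨a, b⟩) ha h
  funext t
  ext1 z
  have h3 := congrArg (fun T => (toCplx Ω).symm (T (toCplx Ω z))) (congrFun h2 t)
  simpa [coupledSemigroup] using h3

lemma coupledSemigroup_injective {a b : ℝ} (ha : 0 < a) {t : ℝ≥0} (ht : 0 < t) {z : L2Vec Ω 2}
    (hz : coupledSemigroup Ω a b t z = 0) : z = 0 := by
  have h := toCplx_coupledSemigroup Ω a b t z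
  rw [hz, map_zero] at h
  have := (isResolvent_complexResolvent Ω).heatOp_injective
    (by simpa using mul_pos ha ht) h.symm
  simpa using this

/-- The constant `1` works: boundedness of `Ω` gives finite measure, and openness with nonemptiness
gives positive measure. -/
lemma exists_ne_zero_L2Scal (hΩ : (Ω : Set (Eucl d)).Nonempty)
    (hΩb : Bornology.IsBounded (Ω : Set (Eucl d))) : ∃ h : L2Scal Ω, h ≠ 0 := by
  have hfin : volΩ Ω Set.univ ≠ ∞ := by simpa using hΩb.measure_lt_top.ne
  refine ⟨indicatorConstLp 2 MeasurableSet.univ hfin 1, fun h => ?_⟩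
  have h1 := norm_indicatorConstLp (p := 2) (hs := MeasurableSet.univ) (hμs := hfin) (c := (1 : ℝ))
    (by simp) (by simp)
  rw [h, norm_zero] at h1
  have h2 : 0 < (volΩ Ω).real Set.univ := by
    rw [measureReal_def]
    refine ENNReal.toReal_pos ?_ hfin
    simpa using (Ω.isOpen.measure_pos volume hΩ).ne'
  have := Real.rpow_pos_of_pos h2 (1 / (2 : ℝ≥0∞).toReal)
  simp only [norm_one, one_mul] at h1
  linarith

/-- Some nonzero initial state is unobservable at the time `S`. -/
theorem exists_unobservable (hΩ : (Ω : Set (Eucl d)).Nonempty)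
    (hΩb : Bornology.IsBounded (Ω : Set (Eucl d))) {a : ℝ} (b : ℝ) (ha : 0 < a) {S : ℝ≥0}
    (hS : 0 < S) : ∃ z : L2Vec Ω 2, z ≠ 0 ∧ obsB Ω (coupledSemigroup Ω a b S z) = 0 := by
  have hR := isResolvent_complexResolvent Ω
  obtain ⟨h, hh⟩ := exists_ne_zero_L2Scal Ω hΩ hΩb
  have hpos : ∀ b' : ℝ, 0 < ((⟨a, b'⟩ : ℂ) * (S : ℝ)).re := fun b' => by
    simpa using mul_pos ha hS
  -- The conjugate parameter `a - i b` cancels the rotation of `a + i b`: the two times add up to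
  -- the real number `2 a S`, so `exp(c S Δ) g` is real and multiplication by `i` makes it purely
  -- imaginary.
  set g := heatOp (complexResolvent Ω) (⟨a, -b⟩ * (S : ℝ)) (ofRealL _ h) with hg
  have hg0 : g ≠ 0 := by
    intro h0
    have := congrArg (reL _) (hR.heatOp_injective (hpos _) h0)
    rw [reL_ofRealL, map_zero] at this
    exact hh this
  refine ⟨(toCplx Ω).symm (Complex.I • g), ?_, ?_⟩
  · simpa using hg0
  · have e : (⟨a, b⟩ : ℂ) * (S : ℝ) + ⟨a, -b⟩ * (S : ℝ) = ((2 * a * S : ℝ) : ℂ) := by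
      apply Complex.ext <;> simp
      ring
    rw [obsB, ← reL_toCplx, toCplx_coupledSemigroup, ContinuousLinearEquiv.apply_symm_apply,
      map_smul, reL_smul, hg, ← mul_apply_eq_comp, hR.heatOp_mul (hpos _) (hpos _), e,
      heatOp_mem_realOperators hR (complexify_mem_realOperators _) _ h]
    simp

lemma obsNorm_zero (ω : Set (Eucl d)) : obsNorm Ω ω 0 = 0 := by
  refine integral_eq_zero_of_ae ?_
  filter_upwards [Lp.coeFn_zero ℝ 2 (volΩ Ω)] with x hx
  by_cases h : x ∈ ω
  · rw [Set.indicator_of_mem h, hx, Pi.zero_apply, abs_zero]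
  · simp [h]

end CoupledSystem

end CoupledParabolic

end

theorem proposition3p3 {d : ℕ} (hd : 0 < d)
    (Ω : TopologicalSpace.Opens (CoupledParabolic.Eucl d))
    (hΩ : (Ω : Set (CoupledParabolic.Eucl d)).Nonempty)
    (hΩb : Bornology.IsBounded (Ω : Set (CoupledParabolic.Eucl d)))
    (a b : ℝ) (ha : 0 < a) (hb : b ≠ 0) :
    (∃! E : ℝ≥0 → CoupledParabolic.L2Vec Ω 2 →L[ℝ] CoupledParabolic.L2Vec Ω 2,
      CoupledParabolic.IsSemigroupGeneratedBy (CoupledParabolic.opA Ω a b) E) ∧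
    ∀ E : ℝ≥0 → CoupledParabolic.L2Vec Ω 2 →L[ℝ] CoupledParabolic.L2Vec Ω 2,
      CoupledParabolic.IsSemigroupGeneratedBy (CoupledParabolic.opA Ω a b) E →
      ∀ T S : ℝ≥0, 0 < S → S < T →
        (∃ z : CoupledParabolic.L2Vec Ω 2, z ≠ 0 ∧ CoupledParabolic.obsB Ω (E S z) = 0) ∧
        ∀ ω : Set (CoupledParabolic.Eucl d), ω ⊆ Ω →
          MeasureTheory.NullMeasurableSet ω MeasureTheory.volume →
          0 < MeasureTheory.volume ω →
          ∀ θ : ℝ, 0 < θ → θ < 1 →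
            ¬ ∃ C : ℝ, 0 < C ∧ ∀ z : CoupledParabolic.L2Vec Ω 2,
              ‖E T z‖ ≤
                C * CoupledParabolic.obsNorm Ω ω (CoupledParabolic.obsB Ω (E S z)) ^ (1 - θ)
                  * ‖z‖ ^ θ := by
  open CoupledParabolic in
  refine ⟨⟨coupledSemigroup Ω a b, isSemigroupGeneratedBy_coupledSemigroup Ω ha,
    fun E hE => eq_coupledSemigroup Ω ha hE⟩, ?_⟩
  intro E hE T S hS hST
  obtain rfl := eq_coupledSemigroup Ω ha hE
  obtain ⟨z, hz0, hz⟩ := exists_unobservable Ω hΩ hΩb b ha hS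
  refine ⟨⟨z, hz0, hz⟩, ?_⟩
  rintro ω - - - θ - hθ ⟨C, -, hC⟩
  have h := hC z
  -- Here `θ < 1` matters: `0 ^ (1 - θ) = 0` requires a nonzero exponent.
  rw [hz, obsNorm_zero, Real.zero_rpow (by linarith), mul_zero, zero_mul, norm_le_zero_iff] at h
  exact hz0 (coupledSemigroup_injective Ω ha (hS.trans hST) h)
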